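/- For every $n\in\mathbb{N}$ there is a constant $C(n)$, depending only on $n$, such that the following holds. Let $\mu$ be an isotropic log-concave measure on $\mathbb{R}^n$ with isotropic constant $1$, that is, a Borel probability measure which has a density of the form $e^{-V}$ with respect to Lebesgue measure on some affine subspace $L$ of $\mathbb{R}^n$, where $V\colon L\to(-\infty,+\infty]$ is convex, which is absolutely continuous with respect to Lebesgue measure on $\mathbb{R}^n$, and which satisfies $$\int_{\mathbb{R}^n}(x,\theta)\,\mu(dx)=0,\qquad \int_{\mathbb{R}^n}(x,\theta)^2\,\mu(dx)=|\theta|^2\qquad\text{for all }\theta\in\mathbb{R}^n.$$ Let $h\in\mathbb{R}^n$ be a vector of unit length. Then $\mu$ has a Skorohod derivative $D_h\mu$ along $h$, that is, a bounded signed Borel measure $D_h\mu$ on $\mathbb{R}^n$ with $$\int_{\mathbb{R}^n}\partial_h\varphi(x)\,\mu(dx)=-\int_{\mathbb{R}^n}\varphi(x)\,D_h\mu(dx)$$ for every bounded smooth function $\varphi$ on $\mathbb{R}^n$ with bounded derivatives of all orders, and any such measure has total variation $$\|D_h\mu\|\le C(n).$$ -/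

import Mathlib

open MeasureTheory Set
open scoped ContDiff

/-- A probability Borel measure `μ` on `ℝⁿ` is log-concave if it has a density `e^{-V}` with respect
to Lebesgue measure on some affine subspace `p + W`, where `V` is convex with values in
`(-∞, +∞]`. The affine subspace is parametrized by `w ↦ p + w`, `w ∈ W`, and `V` is written as a
function of `w`; Lebesgue measure on `p + W` is the image of the Lebesgue measure `volume` of the
Euclidean space `W`. -/
def IsLogConcave {n : ℕ} (μ : Measure (EuclideanSpace ℝ (Fin n))) : Prop :=
  IsProbabilityMeasure μ ∧
    ∃ (W : Submodule ℝ (EuclideanSpace ℝ (Fin n))) (p : EuclideanSpace ℝ (Fin n)) (V : W → EReal),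
      (∀ w, V w ≠ ⊥) ∧
      (∀ w₁ w₂ : W, ∀ a b : ℝ, 0 < a → 0 < b → a + b = 1 →
        V (a • w₁ + b • w₂) ≤ (a : EReal) * V w₁ + (b : EReal) * V w₂) ∧
      μ = ((volume : Measure W).withDensity (fun w => EReal.exp (-V w))).map
        (fun w : W => p + (w : EuclideanSpace ℝ (Fin n)))

/-- `μ` is an isotropic log-concave measure on `ℝⁿ` with isotropic constant `L`. Integrability of
`(x, θ)²`, and hence of `(x, θ)`, is part of this: a Bochner integral with a non-zero value is the
integral of an integrable function. -/
structure IsIsotropicLogConcave {n : ℕ} (μ : Measure (EuclideanSpace ℝ (Fin n))) (L : ℝ) :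
    Prop where
  isLogConcave : IsLogConcave μ
  absolutelyContinuous : μ ≪ volume
  const_pos : 0 < L
  mean_eq_zero : ∀ θ : EuclideanSpace ℝ (Fin n), ∫ x, inner ℝ x θ ∂μ = 0
  integral_sq : ∀ θ : EuclideanSpace ℝ (Fin n),
    ∫ x, (inner ℝ x θ) ^ 2 ∂μ = L ^ 2 * ‖θ‖ ^ 2

/-- The class `C_b^∞(ℝⁿ)` of bounded smooth functions with bounded derivatives of all orders. -/
def IsCbSmooth {n : ℕ} (φ : EuclideanSpace ℝ (Fin n) → ℝ) : Prop :=
  ContDiff ℝ ∞ φ ∧ ∀ k : ℕ, ∃ M : ℝ, ∀ x, ‖iteratedFDeriv ℝ k φ x‖ ≤ M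

/-- The (finite) signed Borel measure `ν` is the Skorohod derivative `D_h μ` of `μ` along `h`:
`∫ ∂_h φ dμ = -∫ φ dν` for every `φ ∈ C_b^∞(ℝⁿ)`. -/
def IsSkorohodDerivative {n : ℕ} (μ : Measure (EuclideanSpace ℝ (Fin n)))
    (h : EuclideanSpace ℝ (Fin n)) (ν : SignedMeasure (EuclideanSpace ℝ (Fin n))) : Prop :=
  ∀ φ : EuclideanSpace ℝ (Fin n) → ℝ, IsCbSmooth φ →
    ∫ x, fderiv ℝ φ x h ∂μ = -∫ᵛ x, φ x ∂<•ν

open Filter Topology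

/-! Let `f` be the density, `A = 2 ^ (n + 4)` and `K` the set where `f ≥ sup f / A`. The proof shows
that translates of `f` along `h` are Lipschitz in `L¹` with a constant depending only on `n`.

Isotropy forces `K` to contain two points `x₀` and `x₀ + h / 3` (`exists_segment`). Otherwise `h /
3` is not a difference of points of `K`, and Hahn-Banach gives a vector `θ` in whose direction `K`
has width at most `‖θ‖ / 3`. Log-concavity makes `f` small away from `K`, so the second moment of
`f` about a near-maximizer in this direction is at most `8 * (‖θ‖ / 3) ^ 2 < ‖θ‖ ^ 2`
(`integral_sq_le_of_width`), less than isotropy allows.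

Let `v = h / 3`. Interpolating `x` with `x₀`, and `x - s • v` with `x₀ + v`, with weights `1 / (1 +
s)` and `s / (1 + s)`, gives the same point. So `f x` and `f (x - s • v)` have a common majorant of
integral `A ^ s * (1 + s) ^ n`, while both have integral one; hence their `L¹` distance is `O(s)`
(`integral_abs_sub_translate_le_rpow`).

The difference quotients of `f` along `h` are thus bounded in `L¹`. A vague limit of them gives the
derivative, and the same bound, tested against smooth functions, controls the total variation of any
Skorohod derivative. -/

/-- A nonnegative function `f` is log-concave if `f x ^ a * f y ^ b ≤ f (a • x + b • y)` for all
positive weights `a + b = 1`. -/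
structure IsLogConcaveFun {E : Type*} [AddCommGroup E] [Module ℝ E] (f : E → ℝ) : Prop where
  nonneg : ∀ x, 0 ≤ f x
  rpow_mul_rpow_le : ∀ x y : E, ∀ a b : ℝ, 0 < a → 0 < b → a + b = 1 →
    f x ^ a * f y ^ b ≤ f (a • x + b • y)

/-! ### Pointwise inequalities for log-concave functions -/

namespace IsLogConcaveFun

section Module

variable {E : Type*} [AddCommGroup E] [Module ℝ E] {f : E → ℝ}

lemma min_le (hf : IsLogConcaveFun f) (x y : E) {a b : ℝ} (ha : 0 < a) (hb : 0 < b)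
    (hab : a + b = 1) : min (f x) (f y) ≤ f (a • x + b • y) := by
  refine le_trans ?_ (hf.rpow_mul_rpow_le x y a b ha hb hab)
  have h0 : 0 ≤ min (f x) (f y) := le_min (hf.nonneg x) (hf.nonneg y)
  calc min (f x) (f y) = min (f x) (f y) ^ a * min (f x) (f y) ^ b := by
        rw [← Real.rpow_add' h0 (by rw [hab]; norm_num), hab, Real.rpow_one]
    _ ≤ f x ^ a * f y ^ b := by
        gcongr
        · exact Real.rpow_nonneg (hf.nonneg x) a
        · exact min_le_left _ _
        · exact min_le_right _ _

lemma convex_superlevel (hf : IsLogConcaveFun f) (s : ℝ) : Convex ℝ {x | s < f x} := by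
  rw [convex_iff_forall_pos]
  intro x hx y hy a b ha hb hab
  exact lt_of_lt_of_le (lt_min hx hy) (hf.min_le x y ha hb hab)

/-- This is the set `K` where `f ≥ sup f / A`, written without the supremum so that boundedness of
`f` need not be known yet. -/
lemma convex_setOf_forall_le_mul (hf : IsLogConcaveFun f) {A : ℝ} (hA : 0 < A) :
    Convex ℝ {x | ∀ y, f y ≤ A * f x} := by
  rw [convex_iff_forall_pos]
  intro x hx y hy a b ha hb hab w
  have h := hf.min_le x y ha hb hab
  have hx' := hx w
  have hy' := hy w
  have : f w / A ≤ min (f x) (f y) := by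
    refine le_min ?_ ?_ <;> rw [div_le_iff₀' hA] <;> assumption
  calc f w = A * (f w / A) := by field_simp
    _ ≤ _ := by gcongr; exact this.trans h

lemma mul_le_sq_midpoint (hf : IsLogConcaveFun f) (x y : E) :
    f x * f y ≤ f ((2 : ℝ)⁻¹ • (x + y)) ^ 2 := by
  have h := hf.rpow_mul_rpow_le x y 2⁻¹ 2⁻¹ (by norm_num) (by norm_num) (by norm_num)
  rw [← smul_add] at h
  have h0 : ∀ z : ℝ, 0 ≤ z → (z ^ (2⁻¹ : ℝ)) ^ 2 = z := fun z hz => by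
    rw [← Real.rpow_natCast, ← Real.rpow_mul hz]; norm_num
  calc f x * f y = (f x ^ (2⁻¹ : ℝ) * f y ^ (2⁻¹ : ℝ)) ^ 2 := by
        rw [mul_pow, h0 _ (hf.nonneg x), h0 _ (hf.nonneg y)]
    _ ≤ _ := by
        have := Real.rpow_nonneg (hf.nonneg x) 2⁻¹
        have := Real.rpow_nonneg (hf.nonneg y) 2⁻¹
        gcongr

/-- If the midpoint of `x` and a near-maximizer `x₀` lies far below the maximum, then `f x` is much
smaller than the value at the midpoint. -/
lemma le_mul_midpoint (hf : IsLogConcaveFun f) {x₀ : E} (h0 : 0 < f x₀)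
    (hmax : ∀ x, f x ≤ 2 * f x₀) {A : ℝ} (hA : 0 < A) {x : E}
    (hx : (2 : ℝ)⁻¹ • (x₀ + x) ∉ {x | ∀ y, f y ≤ A * f x}) :
    f x ≤ 2 / A * f ((2 : ℝ)⁻¹ • (x₀ + x)) := by
  simp only [mem_ofPred_eq, not_forall, not_le] at hx
  obtain ⟨y, hy⟩ := hx
  have h1 := hf.mul_le_sq_midpoint x₀ x
  set z := f ((2 : ℝ)⁻¹ • (x₀ + x))
  have hz : 0 ≤ z := hf.nonneg _
  have h2 : z ≤ 2 / A * f x₀ := by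
    rw [div_mul_eq_mul_div, le_div_iff₀' hA]
    exact (hy.trans_le (hmax y)).le
  have : f x₀ * f x ≤ f x₀ * (2 / A * z) := by
    calc _ ≤ z ^ 2 := h1
      _ = z * z := sq z
      _ ≤ z * (2 / A * f x₀) := by gcongr
      _ = _ := by ring
  exact le_of_mul_le_mul_left this h0

/-- Write `f y = f y ^ a * f y ^ b` and apply the hypothesis to the second factor only: moving
towards a point near the maximum costs at most the factor `A ^ b`. -/
lemma le_rpow_mul (hf : IsLogConcaveFun f) {A : ℝ} (hA : 0 < A) {y w : E} (hyw : f y ≤ A * f w)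
    {a b : ℝ} (ha : 0 < a) (hb : 0 < b) (hab : a + b = 1) :
    f y ≤ A ^ b * f (a • y + b • w) := by
  have h := hf.rpow_mul_rpow_le y w a b ha hb hab
  have hy := hf.nonneg y
  calc f y = f y ^ a * f y ^ b := by
        rw [← Real.rpow_add' hy (by rw [hab]; norm_num), hab, Real.rpow_one]
    _ ≤ f y ^ a * (A * f w) ^ b := by
        have := Real.rpow_nonneg hy a
        gcongr
    _ = A ^ b * (f y ^ a * f w ^ b) := by
        rw [Real.mul_rpow hA.le (hf.nonneg w)]; ring
    _ ≤ _ := by gcongr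

end Module

/-! ### Integrable log-concave functions: boundedness and size of `K` -/

section Measure

variable {E : Type*} [NormedAddCommGroup E] [NormedSpace ℝ E] [FiniteDimensional ℝ E]
  [MeasurableSpace E] [BorelSpace E] {f : E → ℝ} (μ : Measure E) [μ.IsAddHaarMeasure]

/-- Superlevel sets are convex, hence measurable up to null sets; `f` itself need not be Borel. -/
lemma aemeasurable (hf : IsLogConcaveFun f) : AEMeasurable f μ := by
  apply NullMeasurable.aemeasurable
  have : @Measurable E ℝ (eventuallyMeasurableSpace inferInstance (ae μ)) _ f := by
    apply measurable_of_Ioi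
    intro s
    exact (hf.convex_superlevel s).nullMeasurableSet μ
  exact this

lemma lintegral_midpoint (g : E → ENNReal) (x₀ : E) :
    ∫⁻ x, g ((2 : ℝ)⁻¹ • (x₀ + x)) ∂μ = 2 ^ Module.finrank ℝ E * ∫⁻ x, g x ∂μ := by
  have h2 : (2 : ℝ)⁻¹ ≠ 0 := by norm_num
  rw [lintegral_add_left_eq_self (μ := μ) (fun x => g ((2 : ℝ)⁻¹ • x)) x₀]
  have := (Homeomorph.smulOfNeZero (2 : ℝ)⁻¹ h2 (α := E)).measurableEmbedding.lintegral_map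
    (μ := μ) g
  simp only [Homeomorph.smulOfNeZero_apply] at this
  rw [← this]
  erw [Measure.map_addHaar_smul μ h2]
  rw [lintegral_smul_measure]
  congr 1
  simp [abs_of_nonneg]

lemma integral_midpoint (g : E → ℝ) (x₀ : E) :
    ∫ x, g ((2 : ℝ)⁻¹ • (x₀ + x)) ∂μ = 2 ^ Module.finrank ℝ E * ∫ x, g x ∂μ := by
  rw [integral_add_left_eq_self (μ := μ) (fun x => g ((2 : ℝ)⁻¹ • x)) x₀,
    Measure.integral_comp_inv_smul μ g 2]
  simp

lemma integrable_midpoint {g : E → ℝ} (hg : Integrable g μ) (x₀ : E) :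
    Integrable (fun x => g ((2 : ℝ)⁻¹ • (x₀ + x))) μ :=
  (hg.comp_smul (by norm_num : (2 : ℝ)⁻¹ ≠ 0)).comp_add_left x₀

variable {μ}

/-- Integrate `√(f x) * √(f y) ≤ f ((x + y) / 2)` over `y` and divide by `∫ √f`. Lower integrals are
used because `√f` is not known to be integrable. -/
lemma exists_forall_le (hf : IsLogConcaveFun f) (hi : Integrable f μ) (hpos : 0 < ∫ x, f x ∂μ) :
    ∃ M, ∀ x, f x ≤ M := by
  set I := ∫⁻ x, ENNReal.ofReal √(f x) ∂μ with hI
  set J := ∫⁻ x, ENNReal.ofReal (f x) ∂μ with hJ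
  have hJtop : J ≠ ⊤ := by
    rw [hJ, ← ofReal_integral_eq_lintegral_ofReal hi (.of_forall hf.nonneg)]
    exact ENNReal.ofReal_ne_top
  have hI0 : I ≠ 0 := by
    intro h
    have hm : AEMeasurable (fun x => ENNReal.ofReal √(f x)) μ :=
      ((hf.aemeasurable μ).sqrt).ennreal_ofReal
    rw [hI, lintegral_eq_zero_iff' hm] at h
    have : f =ᵐ[μ] 0 := by
      filter_upwards [h] with x hx
      have h1 : √(f x) ≤ 0 := by simpa using hx
      have h2 := (Real.sqrt_eq_zero (hf.nonneg x)).1 (le_antisymm h1 (Real.sqrt_nonneg _))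
      simpa using h2
    rw [integral_congr_ae this] at hpos
    simp at hpos
  have key : ∀ x, ENNReal.ofReal √(f x) ≤ 2 ^ Module.finrank ℝ E * J / I := by
    intro x
    rw [ENNReal.le_div_iff_mul_le (.inl hI0) (.inr (ENNReal.mul_ne_top (by simp) hJtop)), hI, hJ,
      ← lintegral_const_mul' _ _ ENNReal.ofReal_ne_top,
      ← lintegral_midpoint μ (fun z => ENNReal.ofReal (f z)) x]
    refine lintegral_mono fun y => ?_
    rw [← ENNReal.ofReal_mul (Real.sqrt_nonneg _), ← Real.sqrt_mul (hf.nonneg x)]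
    apply ENNReal.ofReal_le_ofReal
    rw [Real.sqrt_le_left (hf.nonneg _)]
    exact hf.mul_le_sq_midpoint x y
  have htop : 2 ^ Module.finrank ℝ E * J / I ≠ ⊤ :=
    ENNReal.div_ne_top (ENNReal.mul_ne_top (by simp) hJtop) hI0
  refine ⟨(2 ^ Module.finrank ℝ E * J / I).toReal ^ 2, fun x => ?_⟩
  rw [← Real.sqrt_le_left ENNReal.toReal_nonneg]
  exact (ENNReal.ofReal_le_iff_le_toReal htop).1 (key x)

lemma exists_near_max (hf : IsLogConcaveFun f) (hi : Integrable f μ) (hpos : 0 < ∫ x, f x ∂μ) :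
    ∃ x₀, 0 < f x₀ ∧ ∀ x, f x ≤ 2 * f x₀ := by
  obtain ⟨M, hM⟩ := hf.exists_forall_le hi hpos
  have hb : BddAbove (range f) := ⟨M, by rintro _ ⟨x, rfl⟩; exact hM x⟩
  have hs : 0 < ⨆ x, f x := by
    by_contra! h
    have : f = 0 := funext fun x =>
      le_antisymm ((le_ciSup hb x).trans h) (hf.nonneg x)
    simp [this] at hpos
  obtain ⟨x₀, hx₀⟩ := exists_lt_of_lt_ciSup (half_lt_self hs)
  refine ⟨x₀, (half_pos hs).trans hx₀, fun x => (le_ciSup hb x).trans (by linarith)⟩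

/-- If `K` were null, `le_mul_midpoint` would hold almost everywhere, and integrating it would give
`∫ f ≤ (2 / A) * 2 ^ d * ∫ f < ∫ f`, with `d` the dimension. -/
lemma measure_setOf_forall_le_mul_pos (hf : IsLogConcaveFun f) (hi : Integrable f μ)
    (hpos : 0 < ∫ x, f x ∂μ) {A : ℝ} (hA : 2 * 2 ^ Module.finrank ℝ E < A) :
    μ {x | ∀ y, f y ≤ A * f x} ≠ 0 := by
  intro h
  have hA0 : 0 < A := lt_trans (by positivity) hA
  obtain ⟨x₀, h0, hmax⟩ := hf.exists_near_max hi hpos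
  have hnull : μ ((fun x => (2 : ℝ)⁻¹ • (x₀ + x)) ⁻¹' {x | ∀ y, f y ≤ A * f x}) = 0 := by
    have : (fun x => (2 : ℝ)⁻¹ • (x₀ + x)) ⁻¹' {x | ∀ y, f y ≤ A * f x} =
        (fun x => x₀ + x) ⁻¹' ((fun x => (2 : ℝ)⁻¹ • x) ⁻¹' {x | ∀ y, f y ≤ A * f x}) := rfl
    rw [this, measure_preimage_add, Measure.addHaar_preimage_smul μ (by norm_num), h, mul_zero]
  have hle : ∀ᵐ x ∂μ, f x ≤ 2 / A * f ((2 : ℝ)⁻¹ • (x₀ + x)) := by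
    have : ∀ᵐ x ∂μ, x ∉ (fun x => (2 : ℝ)⁻¹ • (x₀ + x)) ⁻¹' {x | ∀ y, f y ≤ A * f x} :=
      measure_eq_zero_iff_ae_notMem.1 hnull
    filter_upwards [this] with x hx using hf.le_mul_midpoint h0 hmax hA0 hx
  have := integral_mono_ae hi ((integrable_midpoint μ hi x₀).const_mul (2 / A)) hle
  rw [integral_const_mul, integral_midpoint, ← mul_assoc] at this
  have h1 : 2 / A * 2 ^ Module.finrank ℝ E < 1 := by
    rw [div_mul_eq_mul_div, div_lt_one hA0]; exact hA
  nlinarith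

end Measure

end IsLogConcaveFun

/-! ### Width of convex sets -/

/-- If a convex set with nonempty interior contains no pair of points `x`, `x + v`, then its width
with respect to some linear functional `ℓ` is at most `ℓ v`. -/
lemma Convex.exists_width_le {E : Type*} [NormedAddCommGroup E] [NormedSpace ℝ E] {K : Set E}
    (hK : Convex ℝ K) (hne : (interior K).Nonempty) {v : E} (hv : ∀ x ∈ K, x + v ∉ K) :
    ∃ l : StrongDual ℝ E, 0 < l v ∧ ∀ x ∈ K, ∀ y ∈ K, l x - l y ≤ l v := by
  open Pointwise in
  -- The difference set of the interior is open, convex and misses `v`, so it can be separated from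
  -- `v`. It contains `0`, whence `0 < l v`; the width bound passes to `K` by closure.
  have hconv : Convex ℝ (interior K - interior K) := hK.interior.sub hK.interior
  have hopen : IsOpen (interior K - interior K) := isOpen_interior.sub_right
  have hvn : v ∉ interior K - interior K := by
    rintro ⟨x, hx, y, hy, hxy⟩
    apply hv y (interior_subset hy)
    rw [← hxy]
    simpa using interior_subset hx
  obtain ⟨l, hl⟩ := geometric_hahn_banach_open_point hconv hopen hvn
  obtain ⟨p, hp⟩ := hne
  refine ⟨l, by simpa using hl _ (Set.sub_mem_sub hp hp), fun x hx y hy => ?_⟩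
  have hcl : ∀ z ∈ K, z ∈ closure (interior K) := fun z hz => by
    rw [hK.closure_interior_eq_closure_of_nonempty_interior ⟨p, hp⟩]
    exact subset_closure hz
  have hxy : (x, y) ∈ closure (interior K ×ˢ interior K) := by
    rw [closure_prod_eq]; exact ⟨hcl x hx, hcl y hy⟩
  have hclosed : IsClosed {q : E × E | l q.1 - l q.2 ≤ l v} :=
    isClosed_le (by fun_prop) (by fun_prop)
  refine closure_minimal (fun q hq => ?_) hclosed hxy
  have := hl _ (Set.sub_mem_sub hq.1 hq.2)
  rw [map_sub] at this
  exact this.le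

/-- With empty interior, a convex set lies in its frontier, which is null. -/
lemma Convex.interior_nonempty_of_measure_ne_zero {E : Type*} [NormedAddCommGroup E]
    [NormedSpace ℝ E] [FiniteDimensional ℝ E] [MeasurableSpace E] [BorelSpace E] {μ : Measure E}
    [μ.IsAddHaarMeasure] {K : Set E} (hK : Convex ℝ K) (h : μ K ≠ 0) : (interior K).Nonempty := by
  by_contra hne
  rw [not_nonempty_iff_eq_empty] at hne
  apply h
  refine measure_mono_null ?_ (hK.addHaar_frontier μ)
  rw [frontier, hne, sdiff_empty]
  exact subset_closure

/-! ### A segment along `h` with endpoints in `K` -/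

namespace IsLogConcaveFun

section Segment

variable {E : Type*} [NormedAddCommGroup E] [InnerProductSpace ℝ E] [FiniteDimensional ℝ E]
  [MeasurableSpace E] [BorelSpace E] {f : E → ℝ} {μ : Measure E} [μ.IsAddHaarMeasure]

/-- If the set `{f ≥ sup f / A}` has width at most `r` in the direction `θ`, then the second moment
of the density `f` in this direction is at most `8 * r ^ 2`. -/
lemma integral_sq_le_of_width (hf : IsLogConcaveFun f) (hi : Integrable f μ)
    (h1 : ∫ x, f x ∂μ = 1) {x₀ : E} (h0 : 0 < f x₀) (hmax : ∀ x, f x ≤ 2 * f x₀) {A : ℝ}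
    (hA : A = 2 ^ (Module.finrank ℝ E + 4)) {θ : E} {r : ℝ} (hr : 0 < r)
    (hw : ∀ x ∈ {x | ∀ y, f y ≤ A * f x}, ∀ y ∈ {x | ∀ y, f y ≤ A * f x},
      inner ℝ (x - y) θ ≤ r)
    (hint : Integrable (fun x => inner ℝ (x - x₀) θ ^ 2 * f x) μ) :
    ∫ x, inner ℝ (x - x₀) θ ^ 2 * f x ∂μ ≤ 8 * r ^ 2 := by
  set K := {x | ∀ y, f y ≤ A * f x} with hK
  set G : E → ℝ := fun x => inner ℝ (x - x₀) θ ^ 2 * f x with hG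
  have hA0 : 0 < A := by rw [hA]; positivity
  have hA2 : 2 ≤ A := by
    rw [hA, pow_add]
    have : (1 : ℝ) ≤ 2 ^ Module.finrank ℝ E := one_le_pow₀ (by norm_num)
    linarith
  have hx₀ : x₀ ∈ K := fun y => (hmax y).trans (by gcongr)
  -- If the midpoint of `x₀` and `x` is in `K`, the width bound gives `|⟨x - x₀, θ⟩| ≤ 2 * r`. If
  -- not, `f x` is at most `2 / A` times the value at the midpoint, and halving the distance to `x₀`
  -- contributes another factor 4.
  have hpt : ∀ x, G x ≤ 4 * r ^ 2 * f x + 8 / A * G ((2 : ℝ)⁻¹ • (x₀ + x)) := by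
    intro x
    have hmid : inner ℝ ((2 : ℝ)⁻¹ • (x₀ + x) - x₀) θ = 2⁻¹ * inner ℝ (x - x₀) θ := by
      rw [← real_inner_smul_left]
      congr 1
      module
    have hfx := hf.nonneg x
    have hfz := hf.nonneg ((2 : ℝ)⁻¹ • (x₀ + x))
    by_cases hz : (2 : ℝ)⁻¹ • (x₀ + x) ∈ K
    · have e1 := hw _ hz _ hx₀
      have e2 := hw _ hx₀ _ hz
      rw [← neg_sub, inner_neg_left] at e2
      rw [hmid] at e1 e2
      have : inner ℝ (x - x₀) θ ^ 2 ≤ 4 * r ^ 2 := by nlinarith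
      have e3 : 0 ≤ 8 / A * G ((2 : ℝ)⁻¹ • (x₀ + x)) := by positivity
      have e4 : G x ≤ 4 * r ^ 2 * f x := by simp only [hG]; gcongr
      linarith
    · have e1 := hf.le_mul_midpoint h0 hmax hA0 hz
      have e2 : 0 ≤ 4 * r ^ 2 * f x := by positivity
      have e3 : G x ≤ 8 / A * G ((2 : ℝ)⁻¹ • (x₀ + x)) := by
        simp only [hG]
        rw [hmid]
        calc _ ≤ inner ℝ (x - x₀) θ ^ 2 * (2 / A * f ((2 : ℝ)⁻¹ • (x₀ + x))) := by gcongr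
          _ = _ := by ring
      linarith
  have hGm := integrable_midpoint μ hint x₀
  have := integral_mono hint ((hi.const_mul (4 * r ^ 2)).add (hGm.const_mul (8 / A))) hpt
  simp only [Pi.add_apply] at this
  rw [integral_add (hi.const_mul (4 * r ^ 2)) (hGm.const_mul (8 / A)), integral_const_mul,
    integral_const_mul, h1, integral_midpoint μ G] at this
  -- The exponent `d + 4` in `A` makes this coefficient `1 / 2`, so the term is absorbed on the
  -- left.
  have e : 8 / A * (2 ^ Module.finrank ℝ E * ∫ x, G x ∂μ) = 2⁻¹ * ∫ x, G x ∂μ := by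
    rw [hA, pow_add]; field_simp; norm_num
  rw [e] at this
  linarith

/-- An isotropic log-concave density is comparable to its maximum at the two endpoints of some
segment of length `1 / 3` in any given direction. -/
lemma exists_segment (hf : IsLogConcaveFun f) (hi : Integrable f μ) (h1 : ∫ x, f x ∂μ = 1)
    (hint1 : ∀ θ : E, Integrable (fun x => inner ℝ x θ * f x) μ)
    (hint2 : ∀ θ : E, Integrable (fun x => inner ℝ x θ ^ 2 * f x) μ)
    (hmean : ∀ θ : E, ∫ x, inner ℝ x θ * f x ∂μ = 0)
    (hsq : ∀ θ : E, ∫ x, inner ℝ x θ ^ 2 * f x ∂μ = ‖θ‖ ^ 2) {A : ℝ}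
    (hA : A = 2 ^ (Module.finrank ℝ E + 4)) {h : E} (hh : ‖h‖ = 1) :
    ∃ x₀, (∀ y, f y ≤ A * f x₀) ∧ ∀ y, f y ≤ A * f (x₀ + (3 : ℝ)⁻¹ • h) := by
  by_contra! hcon
  have hA0 : 0 < A := by rw [hA]; positivity
  have hpos : 0 < ∫ x, f x ∂μ := by rw [h1]; exact one_pos
  obtain ⟨x₀, h0, hmax⟩ := hf.exists_near_max hi hpos
  have hconv := hf.convex_setOf_forall_le_mul hA0
  have hne := hconv.interior_nonempty_of_measure_ne_zero
    (hf.measure_setOf_forall_le_mul_pos hi hpos (A := A) (by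
      rw [hA, pow_add]
      have : (0 : ℝ) < 2 ^ Module.finrank ℝ E := by positivity
      linarith))
  obtain ⟨l, hl0, hl⟩ := hconv.exists_width_le hne (v := (3 : ℝ)⁻¹ • h) (fun x hx hx' => by
    obtain ⟨y, hy⟩ := hcon x hx
    exact absurd (hx' y) (not_le.2 hy))
  set θ := (InnerProductSpace.toDual ℝ E).symm l with hθ
  have hlθ : ∀ x, l x = inner ℝ x θ := fun x => by
    rw [real_inner_comm, hθ, InnerProductSpace.toDual_symm_apply]
  have hθ0 : 0 < ‖θ‖ := by
    rw [norm_pos_iff]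
    intro h
    rw [hlθ, h, inner_zero_right] at hl0
    exact hl0.false
  have hv : l ((3 : ℝ)⁻¹ • h) ≤ 3⁻¹ * ‖θ‖ := by
    rw [hlθ, real_inner_smul_left]
    have := real_inner_le_norm h θ
    rw [hh, one_mul] at this
    gcongr
  have hexp : ∀ x, inner ℝ (x - x₀) θ ^ 2 * f x = inner ℝ x θ ^ 2 * f x
      - 2 * inner ℝ x₀ θ * (inner ℝ x θ * f x) + inner ℝ x₀ θ ^ 2 * f x := fun x => by
    rw [inner_sub_left]; ring
  have i1 := (hint1 θ).const_mul (2 * inner ℝ x₀ θ)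
  have i2 := hi.const_mul (inner ℝ x₀ θ ^ 2)
  have i3 : Integrable
      (fun x => inner ℝ x θ ^ 2 * f x - 2 * inner ℝ x₀ θ * (inner ℝ x θ * f x)) μ :=
    (hint2 θ).sub i1
  have := hf.integral_sq_le_of_width hi h1 h0 hmax hA (θ := θ) (r := 3⁻¹ * ‖θ‖) (by positivity)
    (fun x hx y hy => by
      rw [inner_sub_left, ← hlθ, ← hlθ]
      exact (hl x hx y hy).trans hv)
    (by simp only [hexp]; exact i3.add i2)
  simp only [hexp] at this
  rw [integral_add i3 i2, integral_sub (hint2 θ) i1, integral_const_mul, integral_const_mul,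
    hmean, hsq, h1] at this
  -- The moment about `x₀` equals `‖θ‖ ^ 2 + ⟨x₀, θ⟩ ^ 2`, yet it is bounded by `8 / 9 * ‖θ‖ ^ 2`.
  nlinarith [sq_nonneg (inner ℝ x₀ θ)]

end Segment

/-! ### Translates are Lipschitz in `L¹` -/

section Translation

variable {E : Type*} [NormedAddCommGroup E] [NormedSpace ℝ E] [FiniteDimensional ℝ E]
  [MeasurableSpace E] [BorelSpace E] {f : E → ℝ} {μ : Measure E} [μ.IsAddHaarMeasure]

/-- Both `f` and its translate lie below the same `g`, so `|u - w| ≤ (g - u) + (g - w)` reduces the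
estimate to the integral of `g`. -/
lemma integral_abs_sub_translate_le_rpow (hf : IsLogConcaveFun f) (hi : Integrable f μ)
    (h1 : ∫ x, f x ∂μ = 1) {A : ℝ} (hA : 1 ≤ A) {x₀ v : E} (h0 : ∀ y, f y ≤ A * f x₀)
    (hv : ∀ y, f y ≤ A * f (x₀ + v)) {s : ℝ} (hs : 0 < s) :
    ∫ x, |f (x - s • v) - f x| ∂μ ≤ 2 * (A ^ s * (1 + s) ^ Module.finrank ℝ E - 1) := by
  have hA0 : 0 < A := one_pos.trans_le hA
  have hs1 : 0 < 1 + s := by positivity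
  set a := (1 + s)⁻¹ with ha
  set b := s * (1 + s)⁻¹ with hb
  have hapos : 0 < a := by positivity
  have hbpos : 0 < b := by positivity
  have hab : a + b = 1 := by rw [ha, hb]; field_simp
  have hbs : A ^ b ≤ A ^ s := by
    apply Real.rpow_le_rpow_of_exponent_le hA
    rw [hb, ← div_eq_mul_inv]
    exact div_le_self hs.le (by linarith)
  set g : E → ℝ := fun x => A ^ s * f (a • (x + s • x₀)) with hg
  have e1 : ∀ x, f x ≤ g x := fun x => by
    have := hf.le_rpow_mul hA0 (h0 x) hapos hbpos hab
    have e : a • x + b • x₀ = a • (x + s • x₀) := by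
      rw [smul_add, smul_smul, hb, ha, mul_comm s]
    rw [e] at this
    refine this.trans ?_
    have := hf.nonneg (a • (x + s • x₀))
    simp only [hg]; gcongr
  have e2 : ∀ x, f (x - s • v) ≤ g x := fun x => by
    have := hf.le_rpow_mul hA0 (hv (x - s • v)) hapos hbpos hab
    have e : a • (x - s • v) + b • (x₀ + v) = a • (x + s • x₀) := by
      rw [hb, ← ha]; module
    rw [e] at this
    refine this.trans ?_
    have := hf.nonneg (a • (x + s • x₀))
    simp only [hg]; gcongr
  have ig : Integrable g μ :=
    ((hi.comp_smul hapos.ne').comp_add_right (s • x₀)).const_mul _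
  have iv : Integrable (fun x => f (x - s • v)) μ := hi.comp_sub_right _
  have Ig : ∫ x, g x ∂μ = A ^ s * (1 + s) ^ Module.finrank ℝ E := by
    simp only [hg]
    rw [integral_const_mul, integral_add_right_eq_self (μ := μ) (fun x => f (a • x)) (s • x₀),
      ha, Measure.integral_comp_inv_smul μ f (1 + s), h1, abs_of_nonneg (by positivity)]
    simp
  have Iv : ∫ x, f (x - s • v) ∂μ = 1 := by
    rw [integral_sub_right_eq_self (μ := μ) f, h1]
  calc ∫ x, |f (x - s • v) - f x| ∂μ
      ≤ ∫ x, (g x - f (x - s • v)) + (g x - f x) ∂μ := by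
        refine integral_mono (iv.sub hi).abs ((ig.sub iv).add (ig.sub hi)) fun x => ?_
        have := e1 x
        have := e2 x
        simp only
        rw [abs_le]; constructor <;> linarith
    _ = 2 * (A ^ s * (1 + s) ^ Module.finrank ℝ E - 1) := by
        have j1 : Integrable (fun x => g x - f (x - s • v)) μ := ig.sub iv
        have j2 : Integrable (fun x => g x - f x) μ := ig.sub hi
        rw [integral_add j1 j2, integral_sub ig iv, integral_sub ig hi, Ig, Iv,
          h1]
        ring

lemma integral_abs_sub_translate_le (hf : IsLogConcaveFun f) (hi : Integrable f μ)
    (h1 : ∫ x, f x ∂μ = 1) {A : ℝ} (hA : 1 ≤ A) {x₀ h : E} (h0 : ∀ y, f y ≤ A * f x₀)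
    (hv : ∀ y, f y ≤ A * f (x₀ + (3 : ℝ)⁻¹ • h)) {t : ℝ} (ht : 0 < t) (ht1 : t ≤ 1) :
    ∫ x, |f (x - t • h) - f x| ∂μ ≤
      2 * (Real.exp (3 * (Real.log A + Module.finrank ℝ E)) - 1) * t := by
  have hA0 : 0 < A := one_pos.trans_le hA
  have := hf.integral_abs_sub_translate_le_rpow hi h1 hA h0 hv (s := 3 * t) (by positivity)
  have e : (3 * t) • (3 : ℝ)⁻¹ • h = t • h := by
    rw [smul_smul]; congr 1; ring
  rw [e] at this
  refine this.trans ?_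
  set d := Module.finrank ℝ E
  set κ := 3 * (Real.log A + d)
  have h2 : A ^ (3 * t) * (1 + 3 * t) ^ d ≤ Real.exp (t * κ) := by
    calc _ ≤ Real.exp (Real.log A * (3 * t)) * Real.exp (3 * t) ^ d := by
          rw [Real.rpow_def_of_pos hA0]
          gcongr
          linarith [Real.add_one_le_exp (3 * t)]
      _ = Real.exp (t * κ) := by
          rw [← Real.exp_nat_mul, ← Real.exp_add]
          congr 1
          simp only [κ]; ring
  -- The chord of `exp` over `[0, κ]` turns the exponential bound into one linear in `t`.
  have h3 : Real.exp (t * κ) ≤ (1 - t) + t * Real.exp κ := by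
    have := convexOn_exp.2 (mem_univ 0) (mem_univ κ) (sub_nonneg.2 ht1) ht.le (by ring)
    simpa using this
  linarith

end Translation

end IsLogConcaveFun

/-! ### Test functions and difference quotients -/

section CbSmooth

variable {n : ℕ} {φ : EuclideanSpace ℝ (Fin n) → ℝ}

lemma IsCbSmooth.of_hasCompactSupport (h : ContDiff ℝ ∞ φ) (hc : HasCompactSupport φ) :
    IsCbSmooth φ :=
  ⟨h, fun k => (h.continuous_iteratedFDeriv (m := k)
    (by exact_mod_cast le_top)).bounded_above_of_compact_support (hc.iteratedFDeriv k)⟩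

lemma IsCbSmooth.exists_abs_le (h : IsCbSmooth φ) : ∃ M, ∀ x, |φ x| ≤ M := by
  obtain ⟨M, hM⟩ := h.2 0
  exact ⟨M, fun x => by simpa using hM x⟩

lemma IsCbSmooth.exists_norm_fderiv_le (h : IsCbSmooth φ) : ∃ M, ∀ x, ‖fderiv ℝ φ x‖ ≤ M := by
  obtain ⟨M, hM⟩ := h.2 1
  exact ⟨M, fun x => by simpa [norm_iteratedFDeriv_one] using hM x⟩

lemma IsCbSmooth.differentiable (h : IsCbSmooth φ) : Differentiable ℝ φ :=
  h.1.differentiable (by simp)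

lemma IsCbSmooth.integrable (h : IsCbSmooth φ) (m : Measure (EuclideanSpace ℝ (Fin n)))
    [IsFiniteMeasure m] : Integrable φ m := by
  obtain ⟨M, hM⟩ := h.exists_abs_le
  exact Integrable.of_bound h.1.continuous.aestronglyMeasurable M (.of_forall hM)

/-- Translation invariance moves the difference from `f` to `φ`, whose quotients are bounded by the
mean value inequality; dominated convergence then applies. -/
lemma IsCbSmooth.tendsto_integral_mul_difference_quotient (h : IsCbSmooth φ)
    {f : EuclideanSpace ℝ (Fin n) → ℝ} (hf : Integrable f) (v : EuclideanSpace ℝ (Fin n))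
    {t : ℕ → ℝ} (ht : ∀ k, 0 < t k) (ht0 : Tendsto t atTop (𝓝 0)) :
    Tendsto (fun k => ∫ x, φ x * ((f (x - t k • v) - f x) / t k)) atTop
      (𝓝 (∫ x, fderiv ℝ φ x v * f x)) := by
  obtain ⟨M, hM⟩ := h.exists_abs_le
  obtain ⟨M', hM'⟩ := h.exists_norm_fderiv_le
  have hφm := h.1.continuous.aestronglyMeasurable (μ := volume)
  have hshift : ∀ k, ∫ x, φ x * ((f (x - t k • v) - f x) / t k) =
      ∫ x, (φ (x + t k • v) - φ x) / t k * f x := by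
    intro k
    have i1 : Integrable (fun x => φ x * f (x - t k • v)) :=
      (hf.comp_sub_right (t k • v)).bdd_mul hφm (.of_forall hM)
    have i2 : Integrable (fun x => φ x * f x) := hf.bdd_mul hφm (.of_forall hM)
    have i3 : Integrable (fun x => φ (x + t k • v) * f x) :=
      hf.bdd_mul (h.1.continuous.comp (continuous_add_const _)).aestronglyMeasurable
        (.of_forall fun x => hM _)
    have e1 : ∀ x, φ x * ((f (x - t k • v) - f x) / t k) =
        (φ x * f (x - t k • v) - φ x * f x) / t k := fun x => by ring
    have e2 : ∀ x, (φ (x + t k • v) - φ x) / t k * f x =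
        (φ (x + t k • v) * f x - φ x * f x) / t k := fun x => by ring
    simp only [e1, e2]
    rw [integral_div, integral_div, integral_sub i1 i2, integral_sub i3 i2,
      ← integral_sub_right_eq_self (fun x => φ (x + t k • v) * f x) (t k • v)]
    simp
  simp only [hshift]
  refine tendsto_integral_of_dominated_convergence (fun x => M' * ‖v‖ * |f x|) ?_ ?_ ?_ ?_
  · intro k
    refine AEStronglyMeasurable.mul (Continuous.aestronglyMeasurable ?_) hf.1
    have := h.1.continuous
    fun_prop
  · exact hf.abs.const_mul _
  · intro k
    refine .of_forall fun x => ?_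
    rw [Real.norm_eq_abs, abs_mul]
    gcongr
    rw [abs_div, abs_of_pos (ht k), div_le_iff₀ (ht k)]
    have := Convex.norm_image_sub_le_of_norm_fderiv_le (𝕜 := ℝ) (f := φ) (s := univ) (C := M')
      (fun y _ => h.differentiable y) (fun y _ => hM' y) convex_univ (mem_univ x)
      (mem_univ (x + t k • v))
    rw [add_sub_cancel_left, norm_smul, Real.norm_of_nonneg (ht k).le, Real.norm_eq_abs] at this
    linarith
  · refine .of_forall fun x => ?_
    refine Tendsto.mul_const _ ?_
    have hd := ((h.differentiable x).hasFDerivAt.hasLineDerivAt v).tendsto_slope_zero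
    have ht0' : Tendsto t atTop (𝓝[≠] 0) :=
      tendsto_nhdsWithin_iff.2 ⟨ht0, .of_forall fun k => (ht k).ne'⟩
    refine (hd.comp ht0').congr fun k => ?_
    simp [div_eq_inv_mul]

end CbSmooth

/-! ### Total variation by duality -/

lemma integral_toSignedMeasure_sub {α : Type*} {mα : MeasurableSpace α} {m₁ m₂ : Measure α}
    [IsFiniteMeasure m₁] [IsFiniteMeasure m₂] {φ : α → ℝ} (h₁ : Integrable φ m₁)
    (h₂ : Integrable φ m₂) :
    ∫ᵛ x, φ x ∂<•(m₁.toSignedMeasure - m₂.toSignedMeasure) = ∫ x, φ x ∂m₁ - ∫ x, φ x ∂m₂ := by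
  rw [VectorMeasure.integral_sub_vectorMeasure, VectorMeasure.integral_toSignedMeasure,
    VectorMeasure.integral_toSignedMeasure]
  · simpa [VectorMeasure.Integrable] using h₁
  · simpa [VectorMeasure.Integrable] using h₂

lemma integral_signedMeasure_eq_sub {α : Type*} {mα : MeasurableSpace α} (ν : SignedMeasure α)
    {φ : α → ℝ} (h₁ : Integrable φ ν.toJordanDecomposition.posPart)
    (h₂ : Integrable φ ν.toJordanDecomposition.negPart) :
    ∫ᵛ x, φ x ∂<•ν = ∫ x, φ x ∂ν.toJordanDecomposition.posPart -
      ∫ x, φ x ∂ν.toJordanDecomposition.negPart := by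
  rw [← integral_toSignedMeasure_sub h₁ h₂]
  congr 1
  exact ν.toSignedMeasure_toJordanDecomposition.symm

/-- A signed measure which is bounded by `C` as a functional on smooth functions of sup norm at
most one has total variation at most `C`. -/
lemma totalVariation_univ_le_of_forall_isCbSmooth {n : ℕ}
    {ν : SignedMeasure (EuclideanSpace ℝ (Fin n))} {C : ℝ}
    (hν : ∀ φ : EuclideanSpace ℝ (Fin n) → ℝ, IsCbSmooth φ → (∀ x, |φ x| ≤ 1) →
      |∫ᵛ x, φ x ∂<•ν| ≤ C) :
    ν.totalVariation univ ≤ ENNReal.ofReal C := by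
  set p := ν.toJordanDecomposition.posPart with hp
  set q := ν.toJordanDecomposition.negPart with hq
  have hpq : p ⟂ₘ q := ν.toJordanDecomposition.mutuallySingular
  obtain ⟨S, hS, hpS, hqS⟩ := hpq
  have hpS' : p Sᶜ = p univ := by
    rw [← measure_add_measure_compl hS, hpS, zero_add]
  have hqS' : q S = q univ := by
    rw [← measure_add_measure_compl hS, hqS, add_zero]
  have key : ∀ ε : ℝ, 0 < ε → p.real univ + q.real univ ≤ C + ε := by
    intro ε hε
    have hε4 : ENNReal.ofReal (ε / 4) ≠ 0 := by simp [hε]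
    -- `K₁` and `K₂` carry `p` and `q` up to `ε / 4`. A smooth `φ` equal to `1` on `K₁` and `-1` on
    -- `K₂` loses at most `ε / 2` on each part.
    obtain ⟨K₁, hK₁, hc₁, hl₁⟩ := hS.compl.exists_isCompact_lt_add (measure_ne_top p _) hε4
    obtain ⟨K₂, hK₂, hc₂, hl₂⟩ := hS.exists_isCompact_lt_add (measure_ne_top q _) hε4
    rw [hpS'] at hl₁
    rw [hqS'] at hl₂
    have toReal_le : ∀ (m : Measure (EuclideanSpace ℝ (Fin n))) [IsFiniteMeasure m]
        (K : Set (EuclideanSpace ℝ (Fin n))), m univ < m K + ENNReal.ofReal (ε / 4) →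
        m.real univ ≤ m.real K + ε / 4 := fun m _ K h => by
      have := ENNReal.toReal_mono (by finiteness) h.le
      rwa [ENNReal.toReal_add (by finiteness) (by finiteness),
        ENNReal.toReal_ofReal (by positivity)] at this
    have r₁ := toReal_le p K₁ hl₁
    have r₂ := toReal_le q K₂ hl₂
    have hdisj : Disjoint K₂ K₁ :=
      (disjoint_compl_right (a := S)).mono hK₂ hK₁
    obtain ⟨ψ, hψ0, hψ1, hψ⟩ := exists_contMDiffMap_zero_one_of_isClosed
      (modelWithCornersSelf ℝ (EuclideanSpace ℝ (Fin n))) (n := ⊤) hc₂.isClosed hc₁.isClosed hdisj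
    have hψs : ContDiff ℝ ∞ ψ := ψ.contMDiff.contDiff
    obtain ⟨R, hR⟩ := (hc₁.union hc₂).isBounded.subset_closedBall 0
    let χ : ContDiffBump (0 : EuclideanSpace ℝ (Fin n)) :=
      ⟨max R 1, max R 1 + 1, by positivity, by linarith⟩
    have hχ : ∀ x ∈ K₁ ∪ K₂, χ x = 1 := fun x hx =>
      χ.one_of_mem_closedBall (Metric.closedBall_subset_closedBall (le_max_left _ _) (hR hx))
    set φ : EuclideanSpace ℝ (Fin n) → ℝ := fun x => χ x * (2 * ψ x - 1) with hφ
    have hφs : IsCbSmooth φ :=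
      .of_hasCompactSupport (χ.contDiff.mul ((contDiff_const.mul hψs).sub contDiff_const))
        χ.hasCompactSupport.mul_right
    have hφ1 : ∀ x, |φ x| ≤ 1 := fun x => by
      have h1 := (hψ x).1
      have h2 := (hψ x).2
      rw [hφ, abs_mul, abs_of_nonneg χ.nonneg]
      refine mul_le_one₀ χ.le_one (abs_nonneg _) ?_
      rw [abs_le]; constructor <;> linarith
    have hlow : ∀ (m : Measure (EuclideanSpace ℝ (Fin n))) [IsFiniteMeasure m]
        (K : Set (EuclideanSpace ℝ (Fin n))) (g : EuclideanSpace ℝ (Fin n) → ℝ), IsCompact K →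
        Integrable g m → (∀ x, |g x| ≤ 1) → (∀ x ∈ K, g x = 1) →
        2 * m.real K - m.real univ ≤ ∫ x, g x ∂m := by
      intro m _ K g hK hg hg1 hgK
      have i1 : Integrable (K.indicator fun _ => (2 : ℝ)) m :=
        (integrable_const _).indicator hK.measurableSet
      calc 2 * m.real K - m.real univ = ∫ x, K.indicator (fun _ => (2 : ℝ)) x - 1 ∂m := by
            rw [integral_sub i1 (integrable_const _),
              integral_indicator_const _ hK.measurableSet]
            simp [mul_comm]
        _ ≤ _ := by
            refine integral_mono (i1.sub (integrable_const _)) hg fun x => ?_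
            by_cases hx : x ∈ K
            · simp [hx, hgK x hx]; norm_num
            · simpa [hx] using (abs_le.1 (hg1 x)).1
    have l₁ := hlow p K₁ φ hc₁ (hφs.integrable p) hφ1 fun x hx => by
      simp only [hφ]
      rw [hχ x (.inl hx), hψ1 hx]
      norm_num
    have l₂ := hlow q K₂ (fun x => -φ x) hc₂ (hφs.integrable q).neg
      (fun x => by rw [abs_neg]; exact hφ1 x) fun x hx => by
      simp only [hφ]
      rw [hχ x (.inr hx), hψ0 hx]
      norm_num
    rw [integral_neg] at l₂
    have := (abs_le.1 (hν φ hφs hφ1)).2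
    rw [integral_signedMeasure_eq_sub ν (hφs.integrable p) (hφs.integrable q)] at this
    linarith
  have hle : p.real univ + q.real univ ≤ C := le_of_forall_pos_le_add key
  rw [SignedMeasure.totalVariation, Measure.add_apply]
  rw [← ENNReal.ofReal_toReal (measure_ne_top p univ),
    ← ENNReal.ofReal_toReal (measure_ne_top q univ),
    ← ENNReal.ofReal_add ENNReal.toReal_nonneg ENNReal.toReal_nonneg]
  exact ENNReal.ofReal_le_ofReal hle

/-! ### Vague limits of bounded densities -/

section RieszLimit

open CompactlySupported

variable {E : Type*} [NormedAddCommGroup E] [NormedSpace ℝ E] [FiniteDimensional ℝ E]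
  [MeasurableSpace E] [BorelSpace E]

/-- A sequence of nonnegative densities with bounded integrals has a vague limit along any
ultrafilter, and the limit is a finite measure. -/
lemma exists_finite_measure_tendsto_ultrafilter {m : Measure E} {g : ℕ → E → ℝ} {C : ℝ}
    (hg : ∀ k, Integrable (g k) m) (hg0 : ∀ k x, 0 ≤ g k x) (hC : ∀ k, ∫ x, g k x ∂m ≤ C)
    (U : Ultrafilter ℕ) :
    ∃ ρ : Measure E, IsFiniteMeasure ρ ∧
      ∀ φ : C_c(E, ℝ), Tendsto (fun k => ∫ x, φ x * g k x ∂m) U (𝓝 (∫ x, φ x ∂ρ)) := by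
  have hint : ∀ (φ : C_c(E, ℝ)) k, Integrable (fun x => φ x * g k x) m := fun φ k => by
    obtain ⟨M, hM⟩ := φ.continuous.bounded_above_of_compact_support φ.hasCompactSupport
    exact (hg k).bdd_mul φ.continuous.aestronglyMeasurable (.of_forall hM)
  have hbound : ∀ (φ : C_c(E, ℝ)) M k, 0 ≤ M → (∀ x, |φ x| ≤ M) →
      |∫ x, φ x * g k x ∂m| ≤ M * C := fun φ M k hM0 hM => by
    calc |∫ x, φ x * g k x ∂m| ≤ ∫ x, |φ x * g k x| ∂m := abs_integral_le_integral_abs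
      _ ≤ ∫ x, M * g k x ∂m := by
          refine integral_mono (hint φ k).abs ((hg k).const_mul M) fun x => ?_
          simp only [abs_mul, abs_of_nonneg (hg0 k x)]
          exact mul_le_mul_of_nonneg_right (hM x) (hg0 k x)
      _ ≤ M * C := by
          rw [integral_const_mul]
          exact mul_le_mul_of_nonneg_left (hC k) hM0
  -- Bounded real sequences converge along an ultrafilter, so one limit serves all `φ` at once and
  -- is automatically linear and positive.
  have hlim : ∀ φ : C_c(E, ℝ), ∃ l, Tendsto (fun k => ∫ x, φ x * g k x ∂m) U (𝓝 l) := by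
    intro φ
    obtain ⟨M, hM⟩ := φ.continuous.bounded_above_of_compact_support φ.hasCompactSupport
    have hM0 : 0 ≤ M := (norm_nonneg _).trans (hM 0)
    obtain ⟨l, -, hl⟩ := (isCompact_Icc (a := -(M * C)) (b := M * C)).ultrafilter_le_nhds
      (U.map fun k => ∫ x, φ x * g k x ∂m) (by
        rw [Ultrafilter.coe_map, le_principal_iff, mem_map]
        exact univ_mem' fun k => abs_le.1 (hbound φ M k hM0 hM))
    exact ⟨l, hl⟩
  choose L hL using hlim
  let Λ : C_c(E, ℝ) →ₚ[ℝ] ℝ := PositiveLinearMap.mk₀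
    { toFun := L
      map_add' := fun φ ψ => tendsto_nhds_unique (hL (φ + ψ)) (by
        refine ((hL φ).add (hL ψ)).congr fun k => ?_
        rw [← integral_add (hint φ k) (hint ψ k)]
        simp [add_mul])
      map_smul' := fun c φ => tendsto_nhds_unique (hL (c • φ)) (by
        refine ((hL φ).const_mul c).congr fun k => ?_
        rw [← integral_const_mul]
        simp [mul_assoc]) }
    (fun φ hφ => ge_of_tendsto' (hL φ) fun k =>
      integral_nonneg fun x => mul_nonneg (hφ x) (hg0 k x))
  have hΛ : ∀ φ, Λ φ = L φ := fun φ => rfl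
  refine ⟨RealRMK.rieszMeasure Λ, ⟨?_⟩, fun φ => ?_⟩
  · have hball : ∀ k : ℕ, RealRMK.rieszMeasure Λ (Metric.closedBall 0 k) ≤ ENNReal.ofReal C := by
      intro k
      have hK := isCompact_closedBall (0 : E) (k : ℝ)
      obtain ⟨χ, hχ1, -, hχc, hχI⟩ :=
        exists_continuous_one_zero_of_isCompact hK isClosed_empty (disjoint_empty _)
      refine (RealRMK.rieszMeasure_le_of_eq_one Λ (f := ⟨χ, hχc⟩) (fun x => (hχI x).1) hK
        hχ1).trans (ENNReal.ofReal_le_ofReal ?_)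
      rw [hΛ]
      refine le_of_tendsto' (hL _) fun j => ?_
      have := hbound ⟨χ, hχc⟩ 1 j zero_le_one
        (fun x => (abs_of_nonneg (hχI x).1).trans_le (hχI x).2)
      rw [one_mul] at this
      exact (abs_le.1 this).2
    refine lt_of_le_of_lt ?_ (ENNReal.ofReal_lt_top (r := C))
    rw [← Metric.iUnion_closedBall_nat (0 : E)]
    rw [Monotone.measure_iUnion (fun i j hij =>
      Metric.closedBall_subset_closedBall (by exact_mod_cast hij))]
    exact iSup_le hball
  · rw [RealRMK.integral_rieszMeasure]
    exact hL φ

end RieszLimit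

lemma exists_seq_pos_le_one_tendsto_zero :
    ∃ s : ℕ → ℝ, (∀ k, 0 < s k) ∧ (∀ k, s k ≤ 1) ∧ Tendsto s atTop (𝓝 0) := by
  refine ⟨fun k => 1 / ((k : ℝ) + 1), fun k => by positivity, fun k => ?_,
    tendsto_one_div_add_atTop_nhds_zero_nat⟩
  have : (0 : ℝ) ≤ k := k.cast_nonneg
  rw [div_le_one (by positivity)]
  linarith

/-! ### Existence and bound of the Skorohod derivative -/

section Skorohod

variable {n : ℕ}

/-- Compactly supported smooth functions suffice to test a Skorohod derivative. -/
lemma isSkorohodDerivative_of_hasCompactSupport {μ : Measure (EuclideanSpace ℝ (Fin n))}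
    [IsFiniteMeasure μ] {h : EuclideanSpace ℝ (Fin n)}
    {m₁ m₂ : Measure (EuclideanSpace ℝ (Fin n))} [IsFiniteMeasure m₁] [IsFiniteMeasure m₂]
    (H : ∀ φ : EuclideanSpace ℝ (Fin n) → ℝ, ContDiff ℝ ∞ φ → HasCompactSupport φ →
      ∫ x, fderiv ℝ φ x h ∂μ = ∫ x, φ x ∂m₁ - ∫ x, φ x ∂m₂) :
    IsSkorohodDerivative μ h (m₂.toSignedMeasure - m₁.toSignedMeasure) := by
  intro φ hφ
  rw [integral_toSignedMeasure_sub (hφ.integrable m₂) (hφ.integrable m₁), neg_sub]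
  obtain ⟨M, hM⟩ := hφ.exists_abs_le
  obtain ⟨M', hM'⟩ := hφ.exists_norm_fderiv_le
  let χ : ContDiffBump (0 : EuclideanSpace ℝ (Fin n)) := ⟨1, 2, one_pos, one_lt_two⟩
  have hχs : ContDiff ℝ ∞ χ := χ.contDiff
  have hχd : Differentiable ℝ χ := hχs.differentiable (by simp)
  have hχ1 : ∀ x, |χ x| ≤ 1 := fun x => (abs_of_nonneg χ.nonneg).trans_le χ.le_one
  have hχb : IsCbSmooth (χ : EuclideanSpace ℝ (Fin n) → ℝ) :=
    .of_hasCompactSupport hχs χ.hasCompactSupport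
  obtain ⟨B, hB⟩ := hχb.exists_norm_fderiv_le
  have hB0 : 0 ≤ B := (norm_nonneg _).trans (hB 0)
  have hM0 : 0 ≤ M := (abs_nonneg _).trans (hM 0)
  obtain ⟨s, hs0, hs1, hs⟩ := exists_seq_pos_le_one_tendsto_zero
  -- Cut off by a bump dilated by `1 / s k`; the derivative falling on the bump carries a factor `s
  -- k` and vanishes in the limit.
  let ψ : ℕ → EuclideanSpace ℝ (Fin n) → ℝ := fun k x => χ (s k • x) * φ x
  have hψs : ∀ k, ContDiff ℝ ∞ (ψ k) := fun k =>
    (hχs.comp (contDiff_const_smul (s k))).mul hφ.1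
  have hψc : ∀ k, HasCompactSupport (ψ k) := fun k =>
    (χ.hasCompactSupport.comp_smul (hs0 k).ne').mul_right
  have hψd : ∀ k x, fderiv ℝ (ψ k) x h =
      χ (s k • x) * fderiv ℝ φ x h + φ x * (s k * fderiv ℝ χ (s k • x) h) := by
    intro k x
    have e1 : DifferentiableAt ℝ (fun x => χ (s k • x)) x :=
      (hχd _).comp x (differentiableAt_id.const_smul (s k))
    simp only [ψ]
    rw [fderiv_fun_mul e1 (hφ.differentiable x), fderiv_comp_smul]
    simp
  have hχlim : ∀ x, Tendsto (fun k => χ (s k • x)) atTop (𝓝 1) := fun x => by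
    have h1 : Tendsto (fun k => s k • x) atTop (𝓝 0) := by simpa using hs.smul_const x
    have h2 := (χ.continuous.tendsto 0).comp h1
    rwa [χ.one_of_mem_closedBall (Metric.mem_closedBall_self χ.rIn_pos.le)] at h2
  have hlim : ∀ (m : Measure (EuclideanSpace ℝ (Fin n))) [IsFiniteMeasure m],
      Tendsto (fun k => ∫ x, ψ k x ∂m) atTop (𝓝 (∫ x, φ x ∂m)) := by
    intro m _
    refine tendsto_integral_of_dominated_convergence (fun _ => M)
      (fun k => (hψs k).continuous.aestronglyMeasurable) (integrable_const _)
      (fun k => .of_forall fun x => ?_) (.of_forall fun x => ?_)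
    · rw [Real.norm_eq_abs, abs_mul]
      exact (mul_le_of_le_one_left (abs_nonneg _) (hχ1 _)).trans (hM x)
    · simpa using (hχlim x).mul_const (φ x)
  have hlim' : Tendsto (fun k => ∫ x, fderiv ℝ (ψ k) x h ∂μ) atTop
      (𝓝 (∫ x, fderiv ℝ φ x h ∂μ)) := by
    refine tendsto_integral_of_dominated_convergence (fun _ => M' * ‖h‖ + M * (B * ‖h‖))
      (fun k => Continuous.aestronglyMeasurable ?_) (integrable_const _)
      (fun k => .of_forall fun x => ?_) (.of_forall fun x => ?_)
    · exact ((hψs k).continuous_fderiv (by simp)).clm_apply continuous_const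
    · rw [hψd]
      have e1 : ‖fderiv ℝ φ x h‖ ≤ M' * ‖h‖ := ContinuousLinearMap.le_of_opNorm_le _ (hM' x) h
      have e2 : ‖fderiv ℝ χ (s k • x) h‖ ≤ B * ‖h‖ :=
        ContinuousLinearMap.le_of_opNorm_le _ (hB _) h
      have e3 : ‖s k * fderiv ℝ χ (s k • x) h‖ ≤ B * ‖h‖ := by
        rw [norm_mul, Real.norm_of_nonneg (hs0 k).le]
        exact (mul_le_of_le_one_left (norm_nonneg _) (hs1 k)).trans e2
      refine (norm_add_le _ _).trans (add_le_add ?_ ?_)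
      · rw [norm_mul]
        exact (mul_le_of_le_one_left (norm_nonneg _) (hχ1 _)).trans e1
      · rw [norm_mul]
        exact mul_le_mul (hM x) e3 (norm_nonneg _) hM0
    · simp only [hψd]
      have h1 := (hχlim x).mul_const (fderiv ℝ φ x h)
      have h2 : Tendsto (fun k => φ x * (s k * fderiv ℝ χ (s k • x) h)) atTop (𝓝 0) := by
        refine squeeze_zero_norm (a := fun k => M * (B * ‖h‖) * s k) (fun k => ?_)
          (by simpa using hs.const_mul (M * (B * ‖h‖)))
        have e2 : ‖fderiv ℝ χ (s k • x) h‖ ≤ B * ‖h‖ :=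
          ContinuousLinearMap.le_of_opNorm_le _ (hB _) h
        have e3 := hM x
        have := (hs0 k).le
        rw [norm_mul, norm_mul, Real.norm_of_nonneg this, Real.norm_eq_abs (φ x)]
        calc _ ≤ M * (s k * (B * ‖h‖)) := by gcongr
          _ = _ := by ring
      simpa using h1.add h2
  refine tendsto_nhds_unique hlim' (((hlim m₁).sub (hlim m₂)).congr fun k => ?_)
  rw [H _ (hψs k) (hψc k)]

lemma integral_withDensity_ofReal {f : EuclideanSpace ℝ (Fin n) → ℝ} (hf0 : ∀ x, 0 ≤ f x)
    (hf : AEMeasurable f)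
    (g : EuclideanSpace ℝ (Fin n) → ℝ) :
    ∫ x, g x ∂(volume.withDensity fun x => ENNReal.ofReal (f x)) = ∫ x, g x * f x := by
  rw [integral_withDensity_eq_integral_toReal_smul₀ hf.ennreal_ofReal
    (.of_forall fun _ => ENNReal.ofReal_lt_top)]
  congr 1 with x
  rw [ENNReal.toReal_ofReal (hf0 x), smul_eq_mul, mul_comm]

variable {f : EuclideanSpace ℝ (Fin n) → ℝ} {h : EuclideanSpace ℝ (Fin n)} {C : ℝ}

/-- A measure whose density has `L¹`-Lipschitz translates along `h` is Skorohod differentiable. -/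
lemma exists_isSkorohodDerivative (hf0 : ∀ x, 0 ≤ f x) (hf : Integrable f)
    (hL : ∀ t : ℝ, 0 < t → t ≤ 1 → ∫ x, |f (x - t • h) - f x| ≤ C * t) :
    ∃ ν : SignedMeasure (EuclideanSpace ℝ (Fin n)),
      IsSkorohodDerivative (volume.withDensity fun x => ENNReal.ofReal (f x)) h ν := by
  obtain ⟨s, hs0, hs1, hs⟩ := exists_seq_pos_le_one_tendsto_zero
  let g : ℕ → EuclideanSpace ℝ (Fin n) → ℝ := fun k x => (f (x - s k • h) - f x) / s k
  have hg : ∀ k, Integrable (g k) := fun k => ((hf.comp_sub_right _).sub hf).div_const _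
  have hgC : ∀ k, ∫ x, |g k x| ≤ C := fun k => by
    simp only [g, abs_div, abs_of_pos (hs0 k)]
    rw [integral_div, div_le_iff₀ (hs0 k)]
    exact hL _ (hs0 k) (hs1 k)
  have hpos : ∀ u : EuclideanSpace ℝ (Fin n) → ℝ, Integrable u →
      ∫ x, max (u x) 0 ≤ ∫ x, |u x| := fun u hu =>
    integral_mono hu.pos_part hu.abs fun x => max_le (le_abs_self _) (abs_nonneg _)
  -- Positive and negative parts of the quotients converge separately, along the same ultrafilter.
  -- It refines `atTop`, so the limit of the difference is `∫ ∂_h φ * f`.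
  obtain ⟨m₁, hm₁, h₁⟩ := exists_finite_measure_tendsto_ultrafilter
    (g := fun k x => max (g k x) 0) (fun k => (hg k).pos_part) (fun k x => le_max_right _ _)
    (fun k => (hpos _ (hg k)).trans (hgC k)) (hyperfilter ℕ)
  obtain ⟨m₂, hm₂, h₂⟩ := exists_finite_measure_tendsto_ultrafilter
    (g := fun k x => max (-g k x) 0) (fun k => (hg k).neg_part) (fun k x => le_max_right _ _)
    (fun k => (hpos _ (hg k).neg).trans (by simpa using hgC k)) (hyperfilter ℕ)
  have hfin : IsFiniteMeasure (volume.withDensity fun x => ENNReal.ofReal (f x)) :=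
    isFiniteMeasure_withDensity_ofReal hf.2
  refine ⟨_, isSkorohodDerivative_of_hasCompactSupport (m₁ := m₁) (m₂ := m₂) fun φ hφ hc => ?_⟩
  have hφb := IsCbSmooth.of_hasCompactSupport hφ hc
  rw [integral_withDensity_ofReal hf0 hf.1.aemeasurable]
  have t1 := (hφb.tendsto_integral_mul_difference_quotient hf h hs0 hs).mono_left
    Nat.hyperfilter_le_atTop
  have t2 := (h₁ ⟨⟨φ, hφ.continuous⟩, hc⟩).sub (h₂ ⟨⟨φ, hφ.continuous⟩, hc⟩)
  refine tendsto_nhds_unique t1 (t2.congr fun k => ?_)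
  obtain ⟨M, hM⟩ := hφb.exists_abs_le
  have i : ∀ u : EuclideanSpace ℝ (Fin n) → ℝ, Integrable u →
      Integrable fun x => φ x * u x := fun u hu =>
    hu.bdd_mul hφ.continuous.aestronglyMeasurable (.of_forall hM)
  have := integral_sub (i _ (hg k).pos_part) (i _ (hg k).neg_part)
  refine this.symm.trans (integral_congr_ae (.of_forall fun x => ?_))
  have e : max (g k x) 0 - max (-g k x) 0 = g k x := by
    rcases le_total (g k x) 0 with h | h
    · rw [max_eq_right h, max_eq_left (by linarith)]; ring
    · rw [max_eq_left h, max_eq_right (by linarith)]; ring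
  simp only
  rw [← mul_sub, e]

lemma IsSkorohodDerivative.totalVariation_univ_le (hf0 : ∀ x, 0 ≤ f x) (hf : Integrable f)
    (hL : ∀ t : ℝ, 0 < t → t ≤ 1 → ∫ x, |f (x - t • h) - f x| ≤ C * t)
    {ν : SignedMeasure (EuclideanSpace ℝ (Fin n))}
    (hν : IsSkorohodDerivative (volume.withDensity fun x => ENNReal.ofReal (f x)) h ν) :
    ν.totalVariation univ ≤ ENNReal.ofReal C := by
  refine totalVariation_univ_le_of_forall_isCbSmooth fun φ hφ hφ1 => ?_
  rw [← abs_neg, ← hν φ hφ, integral_withDensity_ofReal hf0 hf.1.aemeasurable]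
  obtain ⟨s, hs0, hs1, hs⟩ := exists_seq_pos_le_one_tendsto_zero
  refine le_of_tendsto' (hφ.tendsto_integral_mul_difference_quotient hf h hs0 hs).abs fun k => ?_
  have hg : Integrable fun x => (f (x - s k • h) - f x) / s k :=
    ((hf.comp_sub_right _).sub hf).div_const _
  calc _ ≤ ∫ x, |φ x * ((f (x - s k • h) - f x) / s k)| := abs_integral_le_integral_abs
    _ ≤ ∫ x, |f (x - s k • h) - f x| / s k := by
        refine integral_mono (hg.bdd_mul hφ.1.continuous.aestronglyMeasurable
          (.of_forall hφ1)).abs ((((hf.comp_sub_right _).sub hf).abs).div_const _) fun x => ?_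
        simp only [abs_mul, abs_div, abs_of_pos (hs0 k)]
        exact mul_le_of_le_one_left (div_nonneg (abs_nonneg _) (hs0 k).le) (hφ1 x)
    _ ≤ C := by
        rw [integral_div, div_le_iff₀ (hs0 k)]
        exact hL _ (hs0 k) (hs1 k)

end Skorohod

/-! ### From the log-concave measure to its density -/

/-- The function `e^{-V}` is log-concave if `V` is convex with values in `(-∞, +∞]`. -/
lemma isLogConcaveFun_exp_neg {E : Type*} [AddCommGroup E] [Module ℝ E] {V : E → EReal}
    (hbot : ∀ w, V w ≠ ⊥)
    (hV : ∀ w₁ w₂ : E, ∀ a b : ℝ, 0 < a → 0 < b → a + b = 1 →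
      V (a • w₁ + b • w₂) ≤ (a : EReal) * V w₁ + (b : EReal) * V w₂) :
    IsLogConcaveFun fun w => (EReal.exp (-V w)).toReal := by
  refine ⟨fun _ => ENNReal.toReal_nonneg, fun x y a b ha hb hab => ?_⟩
  have h := hV x y a b ha hb hab
  have hz := hbot (a • x + b • y)
  have hx := hbot x
  have hy := hbot y
  generalize V (a • x + b • y) = z at *
  generalize V x = u at *
  generalize V y = v at *
  induction u with
  | bot => exact absurd rfl hx
  | top => simp [Real.zero_rpow ha.ne']
  | coe u =>
    induction v with
    | bot => exact absurd rfl hy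
    | top => simp [Real.zero_rpow hb.ne']
    | coe v =>
      induction z with
      | bot => exact absurd rfl hz
      | top =>
        rw [← EReal.coe_mul, ← EReal.coe_mul, ← EReal.coe_add, top_le_iff] at h
        exact absurd h (EReal.coe_ne_top _)
      | coe z =>
        have h' : z ≤ a * u + b * v := by exact_mod_cast h
        simp only [← EReal.coe_neg, EReal.exp_coe, ENNReal.toReal_ofReal (Real.exp_pos _).le]
        rw [← Real.exp_mul, ← Real.exp_mul, ← Real.exp_add]
        apply Real.exp_le_exp.2
        linarith

lemma IsLogConcaveFun.comp_linearMap_sub {E F : Type*} [AddCommGroup E] [Module ℝ E]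
    [AddCommGroup F] [Module ℝ F] {f : F → ℝ} (hf : IsLogConcaveFun f) (l : E →ₗ[ℝ] F) (p : E) :
    IsLogConcaveFun fun x => f (l (x - p)) := by
  refine ⟨fun _ => hf.nonneg _, fun x y a b ha hb hab => ?_⟩
  refine (hf.rpow_mul_rpow_le _ _ a b ha hb hab).trans_eq ?_
  rw [← map_smul, ← map_smul, ← map_add]
  congr 2
  have : p = (a + b) • p := by rw [hab, one_smul]
  nth_rw 3 [this]
  module

/-- An absolutely continuous log-concave measure has a log-concave density on the whole space. -/
lemma IsLogConcave.exists_density {n : ℕ} {μ : Measure (EuclideanSpace ℝ (Fin n))}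
    (h : IsLogConcave μ) (hac : μ ≪ volume) :
    ∃ f : EuclideanSpace ℝ (Fin n) → ℝ, IsLogConcaveFun f ∧
      μ = volume.withDensity fun x => ENNReal.ofReal (f x) := by
  obtain ⟨hprob, W, p, V, hbot, hV, hμ⟩ := h
  -- A proper affine subspace is Lebesgue null but would carry all of `μ`.
  have hW : W = ⊤ := by
    by_contra hW
    let S : AffineSubspace ℝ (EuclideanSpace ℝ (Fin n)) := AffineSubspace.mk' p W
    have hS : S ≠ ⊤ := by
      intro hS
      apply hW
      rw [← AffineSubspace.direction_mk' p W, ← AffineSubspace.direction_top ℝ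
        (EuclideanSpace ℝ (Fin n)) (EuclideanSpace ℝ (Fin n))]
      exact congrArg _ hS
    have h0 : μ S = 0 := hac (Measure.addHaar_affineSubspace volume S hS)
    have hmeas : Measurable fun w : W => p + (w : EuclideanSpace ℝ (Fin n)) := by fun_prop
    have hpre : (fun w : W => p + (w : EuclideanSpace ℝ (Fin n))) ⁻¹' S = univ := by
      ext w
      simp [S, AffineSubspace.mem_mk']
    have hSm : MeasurableSet (S : Set (EuclideanSpace ℝ (Fin n))) :=
      S.closed_of_finiteDimensional.measurableSet
    have h1 : μ univ = 0 := by
      rw [hμ, Measure.map_apply hmeas hSm, hpre] at h0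
      rw [hμ, Measure.map_apply hmeas .univ, preimage_univ, h0]
    simp at h1
  let e := LinearIsometryEquiv.ofTop (EuclideanSpace ℝ (Fin n)) W hW
  have hlc := (isLogConcaveFun_exp_neg hbot hV).comp_linearMap_sub
    (e.symm.toLinearEquiv : EuclideanSpace ℝ (Fin n) →ₗ[ℝ] W) p
  refine ⟨_, hlc, ?_⟩
  have he : ∀ w : W, e w = w := fun w => rfl
  have hmp : MeasurePreserving (fun w : W => p + (w : EuclideanSpace ℝ (Fin n))) volume volume :=
    (measurePreserving_add_left volume p).comp e.measurePreserving
  have hemb : MeasurableEmbedding fun w : W => p + (w : EuclideanSpace ℝ (Fin n)) :=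
    (measurableEmbedding_addLeft p).comp e.toHomeomorph.measurableEmbedding
  ext s hs
  rw [hμ, Measure.map_apply hmp.measurable hs, withDensity_apply _ (hmp.measurable hs),
    withDensity_apply _ hs, ← hmp.setLIntegral_comp_preimage_emb hemb]
  refine lintegral_congr fun w => ?_
  have hw : e.symm ((w : EuclideanSpace ℝ (Fin n))) = w := e.symm_apply_apply w
  have hfin : EReal.exp (-V w) ≠ ⊤ := by
    rw [Ne, EReal.exp_eq_top_iff, EReal.neg_eq_top_iff]
    exact hbot w
  simp [hw, ENNReal.ofReal_toReal hfin]

theorem theorem3p1 (n : ℕ) :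
    ∃ C : ℝ, ∀ μ : Measure (EuclideanSpace ℝ (Fin n)), IsIsotropicLogConcave μ 1 →
      ∀ h : EuclideanSpace ℝ (Fin n), ‖h‖ = 1 →
        (∃ ν : SignedMeasure (EuclideanSpace ℝ (Fin n)), IsSkorohodDerivative μ h ν) ∧
        ∀ ν : SignedMeasure (EuclideanSpace ℝ (Fin n)), IsSkorohodDerivative μ h ν →
          ν.totalVariation univ ≤ ENNReal.ofReal C := by
  set d := Module.finrank ℝ (EuclideanSpace ℝ (Fin n))
  set A : ℝ := 2 ^ (d + 4) with hA
  have hA1 : 1 ≤ A := one_le_pow₀ (by norm_num)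
  refine ⟨2 * (Real.exp (3 * (Real.log A + d)) - 1), fun μ hμ h hh => ?_⟩
  obtain ⟨f, hf, rfl⟩ := hμ.isLogConcave.exists_density hμ.absolutelyContinuous
  have hprob := hμ.isLogConcave.1
  have hint := integral_withDensity_ofReal hf.nonneg (hf.aemeasurable volume)
  have h1 : ∫ x, f x = 1 := by
    have := hint fun _ => 1
    simpa using this.symm
  have hi : Integrable f := by
    by_contra hi
    rw [integral_undef hi] at h1
    exact zero_ne_one h1
  have hsq : ∀ θ : EuclideanSpace ℝ (Fin n), ∫ x, inner ℝ x θ ^ 2 * f x = ‖θ‖ ^ 2 := fun θ => by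
    rw [← hint, hμ.integral_sq, one_pow, one_mul]
  have hint2 : ∀ θ : EuclideanSpace ℝ (Fin n), Integrable fun x => inner ℝ x θ ^ 2 * f x := by
    intro θ
    -- A nonzero Bochner integral certifies integrability; for `θ = 0` its value is `0`, so this
    -- case is separate.
    rcases eq_or_ne θ 0 with rfl | hθ
    · simp
    · by_contra hi2
      have := hsq θ
      rw [integral_undef hi2] at this
      exact hθ (norm_eq_zero.1 (pow_eq_zero_iff two_ne_zero |>.1 this.symm))
  have hint1 : ∀ θ : EuclideanSpace ℝ (Fin n), Integrable fun x => inner ℝ x θ * f x := by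
    intro θ
    refine (hi.add (hint2 θ)).mono' (AEStronglyMeasurable.mul
      (Continuous.aestronglyMeasurable (by fun_prop)) hi.1) (.of_forall fun x => ?_)
    rw [Real.norm_eq_abs, abs_mul, abs_of_nonneg (hf.nonneg x), Pi.add_apply]
    have h2 : |inner ℝ x θ| ≤ 1 + inner ℝ x θ ^ 2 := by
      rw [abs_le]; constructor <;>
        nlinarith [sq_nonneg (inner ℝ x θ - 1), sq_nonneg (inner ℝ x θ + 1)]
    nlinarith [hf.nonneg x]
  have hmean : ∀ θ : EuclideanSpace ℝ (Fin n), ∫ x, inner ℝ x θ * f x = 0 := fun θ => by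
    rw [← hint, hμ.mean_eq_zero]
  obtain ⟨x₀, h0, hv⟩ := hf.exists_segment hi h1 hint1 hint2 hmean hsq hA hh
  have hL := fun t ht ht1 => hf.integral_abs_sub_translate_le hi h1 hA1 h0 hv (t := t) ht ht1
  exact ⟨exists_isSkorohodDerivative hf.nonneg hi hL,
    fun ν hν => hν.totalVariation_univ_le hf.nonneg hi hL⟩
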